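/- Let $q\ge 2$ be a real number and write $(x)_n=\prod_{i=0}^{n-1}(1-x/q^{i})$. For a partition $\lambda$ with parts $\lambda_1\ge\lambda_2\ge\cdots$, let $m_j(\lambda)$ be the number of parts equal to $j$ and $\lambda'_j$ the number of parts of size at least $j$. Let $$\tilde P_q(\lambda)=\prod_{i\ge1}\Bigl(1-\frac1{q^i}\Bigr)\,\frac{1}{\prod_{j\ge1}q^{(\lambda'_j)^2}\,(1/q)_{m_j(\lambda)}},$$ and let $P_{n,q}$ be the probability measure on the partitions of $n$ obtained by renormalizing $\tilde P_q$, that is, $P_{n,q}(\lambda)=\tilde P_q(\lambda)\big/\sum_{|\mu|=n}\tilde P_q(\mu)$ for $|\lambda|=n$. For an integer $r\ge 0$ let $P_{n,q}^r$ be the $P_{n,q}$-probability that the largest part $\lambda_1$ is strictly less than $r$. **Theorem.** For $q\ge2$ and integers $n\ge 1$ and $0\le r\le n-1$: 1. $$P_{n,q}^r\le\Bigl(\frac{1}{1-1/q}\Bigr)^2\left[\frac1{q^{2n-2r+2}}+\frac{1}{1-1/q^{2n+1}}\,\frac1{q^{n+1}}\right];$$ 2. $$P_{n,q}^r\ge\frac1{q^{2n-2r+2}}-\frac1{q^{n+1}(1-1/q)}-\frac1{q^{2n-2r+3}(1-1/q)^2}-\frac1{q^{3n-3r+4}(1-1/q)^3}-\frac1{(1-1/q)^2}\,\frac1{q^{2n+3}(1-1/q^{2n+3})}.$$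 -/

import Mathlib

/-- The `q`-series symbol `(x)_n = (1 - x) (1 - x/q) ⋯ (1 - x/q^(n-1))`. -/
noncomputable def qSymbol (q x : ℝ) (n : ℕ) : ℝ :=
  ∏ i ∈ Finset.range n, (1 - x / q ^ i)

namespace Nat.Partition

/-- `m_j(lam)`, the number of parts of `lam` of size `j`. -/
def mult {n : ℕ} (lam : n.Partition) (j : ℕ) : ℕ :=
  lam.parts.count j

/-- `lam'_j`, the `j`-th part of the transpose: the number of parts of `lam` of size at
least `j`, that is `m_j(lam) + m_(j+1)(lam) + ⋯`. -/
def transposePart {n : ℕ} (lam : n.Partition) (j : ℕ) : ℕ :=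
  (lam.parts.filter (fun i => j ≤ i)).card

/-- `lam_1`, the largest part of `lam` (the length of its first row); `0` for the empty
partition. -/
def largestPart {n : ℕ} (lam : n.Partition) : ℕ :=
  lam.parts.sup

end Nat.Partition

/-- The mass at `lam` of the measure `P̃_q` on the set of all partitions of all natural numbers:
`∏_{i ≥ 1} (1 - 1/q^i) / ∏_{j ≥ 1} q^((lam'_j)^2) (1/q)_{m_j(lam)}`.
For a partition of `n` all factors of the second product with `j > n` are equal to `1`. -/
noncomputable def tildeP (q : ℝ) {n : ℕ} (lam : n.Partition) : ℝ :=
  (∏' i : ℕ, (1 - 1 / q ^ (i + 1))) /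
    ∏ j ∈ Finset.Icc 1 n, (q ^ (lam.transposePart j ^ 2) * qSymbol q (1 / q) (lam.mult j))

/-- The mass at `lam` of `P_{n,q}`, the measure `P̃_q` renormalized to live on the partitions
of `n`. -/
noncomputable def sizeP (q : ℝ) {n : ℕ} (lam : n.Partition) : ℝ :=
  tildeP q lam / ∑ mu : n.Partition, tildeP q mu

/-- `P_{n,q}^r`, the `P_{n,q}`-probability that the largest part is strictly less than `r`. -/
noncomputable def sizePLargestLT (n : ℕ) (q : ℝ) (r : ℕ) : ℝ :=
  ∑ lam : n.Partition with lam.largestPart < r, sizeP q lam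

/-! Put `t = 1/q` and scale the weight of a partition by `q` to its size; the scaling and the
infinite product cancel in `P_{n,q}`. Adding a largest part `L` to `s` then multiplies the weight by
`t^(2|s|) / (1 - t^(c+1))`, where `c` is the multiplicity of `L` in `s`: `L` itself enters only
through `c` (`partsWeight_cons`). Hence the totals `Z_n` satisfy `Z_n ≤ ∑_{m<n} Z_m t^(2m) / (1-t)`;
they increase with `n` (`totalWeight_mono`) and stay below `1/(1-t)^2` (`totalWeight_le`).

Upper bound: removing a largest part `L < r` leaves size `n - L ≥ n - r + 1`, and `Z_(n-L) ≤ Z_n`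
reduces the probability to a geometric sum. Lower bound: the single partition `(r-1, n-r+1)`
suffices when it has this order; otherwise the claimed bound is nonpositive. -/

/-! ### Weights and the effect of a new largest part -/

/-- The denominator of the Cohen–Lenstra mass of the partition with parts `s`, truncated to the
columns `1, …, N`. -/
noncomputable def autProd (q : ℝ) (N : ℕ) (s : Multiset ℕ) : ℝ :=
  ∏ j ∈ Finset.Icc 1 N,
    (q ^ ((s.filter (fun i => j ≤ i)).card ^ 2) * qSymbol q (1 / q) (s.count j))

/-- The Cohen–Lenstra weight of a multiset of parts, scaled by `q` to the size. -/
noncomputable def partsWeight (q : ℝ) (s : Multiset ℕ) : ℝ :=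
  q ^ s.sum / autProd q s.sum s

theorem one_div_pow_lt_one {q : ℝ} (hq : 2 ≤ q) (k : ℕ) : 1 / q ^ (k + 1) < 1 := by
  rw [div_lt_one (by positivity)]
  exact one_lt_pow₀ (by linarith) (by omega)

theorem qSymbol_one_div_succ (q : ℝ) (c : ℕ) :
    qSymbol q (1 / q) (c + 1) = qSymbol q (1 / q) c * (1 - 1 / q ^ (c + 1)) := by
  rw [qSymbol, Finset.prod_range_succ, div_div, ← pow_succ', qSymbol]

theorem qSymbol_one_div_pos {q : ℝ} (hq : 2 ≤ q) (c : ℕ) : 0 < qSymbol q (1 / q) c := by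
  induction c with
  | zero => simp [qSymbol]
  | succ c ih =>
    rw [qSymbol_one_div_succ]
    exact mul_pos ih (sub_pos.2 (one_div_pow_lt_one hq c))

theorem autProd_pos {q : ℝ} (hq : 2 ≤ q) (N : ℕ) (s : Multiset ℕ) : 0 < autProd q N s :=
  Finset.prod_pos fun _ _ => mul_pos (by positivity) (qSymbol_one_div_pos hq _)

theorem partsWeight_pos {q : ℝ} (hq : 2 ≤ q) (s : Multiset ℕ) : 0 < partsWeight q s :=
  div_pos (by positivity) (autProd_pos hq _ _)

theorem autProd_eq_of_le (q : ℝ) {M N : ℕ} {s : Multiset ℕ} (hMN : M ≤ N)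
    (hs : ∀ x ∈ s, x ≤ M) : autProd q N s = autProd q M s := by
  symm
  refine Finset.prod_subset (Finset.Icc_subset_Icc_right hMN) fun j hj hj' => ?_
  simp only [Finset.mem_Icc, not_and, not_le] at hj hj'
  have hjM := hj' hj.1
  have h1 : s.filter (fun i => j ≤ i) = 0 :=
    Multiset.filter_eq_nil.2 fun x hx => by have := hs x hx; omega
  have h2 : s.count j = 0 :=
    Multiset.count_eq_zero.2 fun hx => by have := hs j hx; omega
  simp [h1, h2, qSymbol]

theorem sum_card_filter_le (s : Multiset ℕ) {L : ℕ} (hs : ∀ x ∈ s, x ≤ L) :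
    ∑ j ∈ Finset.Icc 1 L, (s.filter (fun i => j ≤ i)).card = s.sum := by
  induction s using Multiset.induction_on with
  | empty => simp
  | cons a s ih =>
    have ha : a ≤ L := hs a (by simp)
    have key : ∑ j ∈ Finset.Icc 1 L, (if j ≤ a then 1 else 0) = a := by
      rw [← Finset.card_filter]
      have : (Finset.Icc 1 L).filter (fun j => j ≤ a) = Finset.Icc 1 a := by
        ext j; simp only [Finset.mem_filter, Finset.mem_Icc]; omega
      simp [this]
    have : ∀ j, ((a ::ₘ s).filter (fun i => j ≤ i)).card
        = (if j ≤ a then 1 else 0) + (s.filter (fun i => j ≤ i)).card := by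
      intro j
      by_cases h : j ≤ a <;> simp [h, add_comm]
    simp only [this, Finset.sum_add_distrib, key, Multiset.sum_cons]
    rw [ih fun x hx => hs x (by simp [hx])]

/-- Each column `1, …, L` grows from `c` to `c + 1`, and `(c+1)^2 - c^2 = 2c + 1`; the column
lengths sum to `s.sum`. -/
theorem autProd_cons {q : ℝ} {L N : ℕ} {s : Multiset ℕ} (hL : 1 ≤ L) (hLN : L ≤ N)
    (hs : ∀ x ∈ s, x ≤ L) :
    autProd q N (L ::ₘ s)
      = autProd q N s * q ^ (2 * s.sum + L) * (1 - 1 / q ^ (s.count L + 1)) := by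
  have hs' : ∀ x ∈ L ::ₘ s, x ≤ L := by
    intro x hx
    rcases Multiset.mem_cons.1 hx with h | h
    exacts [h.le, hs x h]
  rw [autProd_eq_of_le q hLN hs', autProd_eq_of_le q hLN hs]
  have h1 : ∀ j ∈ Finset.Icc 1 L,
      q ^ (((L ::ₘ s).filter (fun i => j ≤ i)).card ^ 2)
          * qSymbol q (1 / q) ((L ::ₘ s).count j)
        = (q ^ ((s.filter (fun i => j ≤ i)).card ^ 2) * qSymbol q (1 / q) (s.count j))
          * q ^ (2 * (s.filter (fun i => j ≤ i)).card + 1)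
          * (if L = j then 1 - 1 / q ^ (s.count L + 1) else 1) := by
    intro j hj
    have hjL := (Finset.mem_Icc.1 hj).2
    rw [Multiset.filter_cons_of_pos _ hjL, Multiset.card_cons]
    by_cases h : L = j
    · subst h
      rw [Multiset.count_cons_self, qSymbol_one_div_succ, if_pos rfl]
      ring
    · rw [Multiset.count_cons_of_ne (Ne.symm h), if_neg h]
      ring
  rw [autProd, Finset.prod_congr rfl h1, Finset.prod_mul_distrib, Finset.prod_mul_distrib,
    Finset.prod_ite_eq, if_pos (Finset.mem_Icc.2 ⟨hL, le_rfl⟩), Finset.prod_pow_eq_pow_sum,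
    Finset.sum_add_distrib, ← Finset.mul_sum, sum_card_filter_le s hs]
  simp [autProd]

/-- Adding a new largest part. -/
theorem partsWeight_cons {q : ℝ} (hq : 2 ≤ q) {L : ℕ} {s : Multiset ℕ} (hL : 1 ≤ L)
    (hs : ∀ x ∈ s, x ≤ L) :
    partsWeight q (L ::ₘ s)
      = partsWeight q s * (1 / q) ^ (2 * s.sum) / (1 - (1 / q) ^ (s.count L + 1)) := by
  have hsum : (L ::ₘ s).sum = L + s.sum := by simp
  rw [partsWeight, hsum, autProd_cons hL (by omega) hs,
    autProd_eq_of_le q (Nat.le_add_left s.sum L) fun x hx => Multiset.le_sum_of_mem hx,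
    partsWeight, one_div_pow, one_div_pow]
  have h1 := (autProd_pos hq s.sum s).ne'
  have h2 := (sub_pos.2 (one_div_pow_lt_one hq (s.count L))).ne'
  have h3 : q ≠ 0 := by positivity
  have h4 : q ^ (2 * s.sum) ≠ 0 := by positivity
  rw [div_mul_eq_mul_div, div_div, div_eq_div_iff (by positivity) (by positivity), pow_add, pow_add]
  field_simp
  ring

theorem partsWeight_zero (q : ℝ) : partsWeight q 0 = 1 := by
  simp [partsWeight, autProd]

/-! ### Partitions as multisets and removal of the largest part -/

/-- The multisets of parts of the partitions of `n`. -/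
def partsFinset (n : ℕ) : Finset (Multiset ℕ) :=
  (Finset.univ : Finset n.Partition).image Nat.Partition.parts

theorem mem_partsFinset {n : ℕ} {s : Multiset ℕ} :
    s ∈ partsFinset n ↔ (∀ x ∈ s, 0 < x) ∧ s.sum = n := by
  simp only [partsFinset, Finset.mem_image, Finset.mem_univ, true_and]
  constructor
  · rintro ⟨p, rfl⟩
    exact ⟨fun x hx => p.parts_pos hx, p.parts_sum⟩
  · rintro ⟨h1, h2⟩
    exact ⟨⟨s, fun {i} hi => h1 i hi, h2⟩, rfl⟩

/-- The total weight of the partitions of `n`. -/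
noncomputable def totalWeight (q : ℝ) (n : ℕ) : ℝ :=
  ∑ s ∈ partsFinset n, partsWeight q s

theorem Multiset.sup_mem_of_sup_pos {s : Multiset ℕ} (h : 0 < s.sup) : s.sup ∈ s := by
  induction s using Multiset.induction_on with
  | empty => simp at h
  | cons a s ih =>
    rw [Multiset.sup_cons] at h ⊢
    rcases le_total s.sup a with h' | h'
    · simp [sup_eq_left.2 h']
    · rw [sup_eq_right.2 h'] at h ⊢
      exact Multiset.mem_cons_of_mem (ih h)

theorem sup_mem_Icc_of_mem_partsFinset {n : ℕ} (hn : 1 ≤ n) {s : Multiset ℕ}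
    (hs : s ∈ partsFinset n) : s.sup ∈ s ∧ s.sup ∈ Finset.Icc 1 n := by
  obtain ⟨h1, h2⟩ := mem_partsFinset.1 hs
  have hne : s ≠ 0 := by rintro rfl; simp at h2; omega
  obtain ⟨x, hx⟩ := Multiset.exists_mem_of_ne_zero hne
  have hpos : 0 < s.sup := (h1 x hx).trans_le (Multiset.le_sup hx)
  have hmem := Multiset.sup_mem_of_sup_pos hpos
  exact ⟨hmem, Finset.mem_Icc.2 ⟨hpos, h2 ▸ Multiset.le_sum_of_mem hmem⟩⟩

theorem one_div_mem_Ioc {q : ℝ} (hq : 2 ≤ q) : 0 < 1 / q ∧ 1 / q ≤ 1 / 2 :=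
  ⟨by positivity, one_div_le_one_div_of_le (by norm_num) hq⟩

theorem partsWeight_cons_le {q : ℝ} (hq : 2 ≤ q) {L : ℕ} {s : Multiset ℕ} (hL : 1 ≤ L)
    (hs : ∀ x ∈ s, x ≤ L) :
    partsWeight q (L ::ₘ s) ≤ partsWeight q s * (1 / q) ^ (2 * s.sum) / (1 - 1 / q) := by
  obtain ⟨ht0, ht⟩ := one_div_mem_Ioc hq
  rw [partsWeight_cons hq hL hs]
  have := partsWeight_pos hq s
  refine div_le_div_of_nonneg_left (by positivity) (by linarith) ?_
  have := pow_le_of_le_one ht0.le (by linarith) (Nat.succ_ne_zero (s.count L))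
  simp only [Nat.succ_eq_add_one] at this
  linarith

/-- Removing the largest part. -/
theorem sum_partsWeight_sup_lt_le {q : ℝ} (hq : 2 ≤ q) {n r : ℕ} (hn : 1 ≤ n) :
    ∑ s ∈ partsFinset n with s.sup < r, partsWeight q s
      ≤ ∑ L ∈ Finset.Ico 1 r, totalWeight q (n - L) * (1 / q) ^ (2 * (n - L)) / (1 - 1 / q) := by
  obtain ⟨ht0, ht⟩ := one_div_mem_Ioc hq
  have hmaps : ∀ s ∈ (partsFinset n).filter (fun s => s.sup < r), s.sup ∈ Finset.Ico 1 r := by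
    intro s hs
    obtain ⟨h1, h2⟩ := Finset.mem_filter.1 hs
    have := (Finset.mem_Icc.1 (sup_mem_Icc_of_mem_partsFinset hn h1).2).1
    exact Finset.mem_Ico.2 ⟨this, h2⟩
  rw [← Finset.sum_fiberwise_of_maps_to hmaps]
  refine Finset.sum_le_sum fun L hL => ?_
  have hL1 := (Finset.mem_Ico.1 hL).1
  rw [totalWeight, Finset.sum_mul, Finset.sum_div]
  set F := {s ∈ {s ∈ partsFinset n | s.sup < r} | s.sup = L} with hF
  have hmem : ∀ s ∈ F, s ∈ partsFinset n ∧ L ∈ s ∧ s.sup = L := by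
    intro s hs
    obtain ⟨h1, h2⟩ := Finset.mem_filter.1 hs
    have h3 := (Finset.mem_filter.1 h1).1
    exact ⟨h3, h2 ▸ (sup_mem_Icc_of_mem_partsFinset hn h3).1, h2⟩
  have hinj : Set.InjOn (fun s : Multiset ℕ => s.erase L) F := by
    intro s hs s' hs' h
    simp only at h
    rw [← Multiset.cons_erase (hmem s hs).2.1, h, Multiset.cons_erase (hmem s' hs').2.1]
  have herase : ∀ s ∈ F, s.erase L ∈ partsFinset (n - L) := by
    intro s hs
    obtain ⟨h1, h2, -⟩ := hmem s hs
    obtain ⟨h3, h4⟩ := mem_partsFinset.1 h1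
    refine mem_partsFinset.2 ⟨fun x hx => h3 x (Multiset.mem_of_mem_erase hx), ?_⟩
    have := congrArg Multiset.sum (Multiset.cons_erase h2)
    rw [Multiset.sum_cons] at this
    omega
  calc ∑ s ∈ F, partsWeight q s
      ≤ ∑ s ∈ F, partsWeight q (s.erase L) * (1 / q) ^ (2 * (n - L)) / (1 - 1 / q) := by
        refine Finset.sum_le_sum fun s hs => ?_
        obtain ⟨h1, h2, h3⟩ := hmem s hs
        have h := partsWeight_cons_le hq (s := s.erase L) hL1 fun x hx =>
          h3 ▸ Multiset.le_sup (Multiset.mem_of_mem_erase hx)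
        rwa [Multiset.cons_erase h2, (mem_partsFinset.1 (herase s hs)).2] at h
    _ = ∑ s ∈ F.image (fun s => s.erase L),
          partsWeight q s * (1 / q) ^ (2 * (n - L)) / (1 - 1 / q) := by
        rw [Finset.sum_image hinj]
    -- Forgetting that the remaining parts are at most `L` only enlarges the sum.
    _ ≤ _ := by
        refine Finset.sum_le_sum_of_subset_of_nonneg (Finset.image_subset_iff.2 herase)
          fun s _ _ => ?_
        have := partsWeight_pos hq s
        exact div_nonneg (by positivity) (by linarith)

/-! ### Monotonicity and boundedness of the total weights -/

theorem totalWeight_zero (q : ℝ) : totalWeight q 0 = 1 := by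
  have : partsFinset 0 = {0} := by
    ext s
    rw [mem_partsFinset, Finset.mem_singleton]
    refine ⟨fun ⟨h1, h2⟩ => Multiset.eq_zero_of_forall_notMem fun x hx => ?_, fun h => by simp [h]⟩
    have := Multiset.le_sum_of_mem hx
    have := h1 x hx
    omega
  rw [totalWeight, this, Finset.sum_singleton, partsWeight_zero]

theorem totalWeight_nonneg {q : ℝ} (hq : 2 ≤ q) (n : ℕ) : 0 ≤ totalWeight q n :=
  Finset.sum_nonneg fun s _ => (partsWeight_pos hq s).le

theorem totalWeight_pos {q : ℝ} (hq : 2 ≤ q) (n : ℕ) : 0 < totalWeight q n :=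
  Finset.sum_pos (fun s _ => partsWeight_pos hq s)
    ((Finset.univ_nonempty (α := n.Partition)).image _)

theorem totalWeight_le_sum {q : ℝ} (hq : 2 ≤ q) {n : ℕ} (hn : 1 ≤ n) :
    totalWeight q n
      ≤ (∑ m ∈ Finset.range n, totalWeight q m * (1 / q) ^ (2 * m)) / (1 - 1 / q) := by
  have h := sum_partsWeight_sup_lt_le hq (r := n + 1) hn
  rw [Finset.filter_true_of_mem fun s hs => by
    have := (Finset.mem_Icc.1 (sup_mem_Icc_of_mem_partsFinset hn hs).2).2
    omega] at h
  refine h.trans_eq ?_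
  rw [Finset.sum_div, Finset.sum_Ico_eq_sum_range, ← Finset.sum_range_reflect]
  refine Finset.sum_congr (by simp) fun k hk => ?_
  have := Finset.mem_range.1 hk
  rw [show n - (1 + (n + 1 - 1 - 1 - k)) = k by omega]

/-- Lengthening the largest part by one does not decrease the weight. -/
theorem totalWeight_le_succ {q : ℝ} (hq : 2 ≤ q) (n : ℕ) :
    totalWeight q n ≤ totalWeight q (n + 1) := by
  obtain ⟨ht0, ht⟩ := one_div_mem_Ioc hq
  -- The empty multiset has `sup = 0` and is sent to `{1}`.
  let f : Multiset ℕ → Multiset ℕ := fun s => (s.sup + 1) ::ₘ s.erase s.sup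
  have hle : ∀ s : Multiset ℕ, ∀ x ∈ s.erase s.sup, x ≤ s.sup := fun s x hx =>
    Multiset.le_sup (Multiset.mem_of_mem_erase hx)
  have hsup : ∀ s : Multiset ℕ, (f s).sup = s.sup + 1 := fun s => by
    have : (s.erase s.sup).sup ≤ s.sup + 1 :=
      Multiset.sup_le.2 fun x hx => (hle s x hx).trans (Nat.le_succ _)
    simp only [f, Multiset.sup_cons]
    exact sup_eq_left.2 this
  have hmem : ∀ s ∈ partsFinset n, s ≠ 0 → s.sup ∈ s ∧ 1 ≤ s.sup := by
    intro s hs h0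
    obtain ⟨x, hx⟩ := Multiset.exists_mem_of_ne_zero h0
    have hpos : 0 < s.sup := ((mem_partsFinset.1 hs).1 x hx).trans_le (Multiset.le_sup hx)
    exact ⟨Multiset.sup_mem_of_sup_pos hpos, hpos⟩
  have hinj : Set.InjOn f (partsFinset n) := by
    intro s hs s' hs' h
    have h1 : s.sup = s'.sup := by
      have := congrArg Multiset.sup h
      rw [hsup, hsup] at this
      omega
    have h2 : s.erase s.sup = s'.erase s.sup := by
      have : f s = f s' := h
      simp only [f, ← h1] at this
      exact (Multiset.cons_inj_right _).1 this
    by_cases h0 : s = 0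
    · by_cases h0' : s' = 0
      · rw [h0, h0']
      · have := (hmem s' hs' h0').2
        simp [h0] at h1
        omega
    · have hs1 := hmem s hs h0
      by_cases h0' : s' = 0
      · simp [h0'] at h1
        omega
      · rw [← Multiset.cons_erase hs1.1, h2, h1, Multiset.cons_erase (hmem s' hs' h0').1]
  have himg : ∀ s ∈ partsFinset n, f s ∈ partsFinset (n + 1) := by
    intro s hs
    obtain ⟨h1, h2⟩ := mem_partsFinset.1 hs
    refine mem_partsFinset.2 ⟨fun x hx => ?_, ?_⟩
    · rcases Multiset.mem_cons.1 hx with h | h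
      · omega
      · exact h1 x (Multiset.mem_of_mem_erase h)
    · simp only [f, Multiset.sum_cons]
      by_cases h0 : s = 0
      · subst h0
        simp at h2 ⊢
        omega
      · have := congrArg Multiset.sum (Multiset.cons_erase (hmem s hs h0).1)
        rw [Multiset.sum_cons] at this
        omega
  have hw : ∀ s ∈ partsFinset n, partsWeight q s ≤ partsWeight q (f s) := by
    intro s hs
    -- The lengthened part has multiplicity one, so its factor `1/(1-t)` is the largest possible.
    have hfs : partsWeight q (f s)
        = partsWeight q (s.erase s.sup) * (1 / q) ^ (2 * (s.erase s.sup).sum) / (1 - 1 / q) := by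
      rw [partsWeight_cons hq (by omega) fun x hx => (hle s x hx).trans (Nat.le_succ _),
        Multiset.count_eq_zero.2 fun hx => by have := hle s _ hx; omega, zero_add, pow_one]
    by_cases h0 : s = 0
    · subst h0
      rw [hfs]
      simp only [Multiset.sup_zero, Multiset.erase_zero, partsWeight_zero, Multiset.sum_zero,
        mul_zero, pow_zero, mul_one]
      rw [le_div_iff₀ (by linarith)]
      linarith
    · obtain ⟨h1, h2⟩ := hmem s hs h0
      rw [hfs]
      have := partsWeight_cons_le hq h2 (hle s)
      rwa [Multiset.cons_erase h1] at this
  calc totalWeight q n ≤ ∑ s ∈ partsFinset n, partsWeight q (f s) := Finset.sum_le_sum hw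
    _ = ∑ s ∈ (partsFinset n).image f, partsWeight q s := by rw [Finset.sum_image hinj]
    _ ≤ _ := Finset.sum_le_sum_of_subset_of_nonneg (Finset.image_subset_iff.2 himg)
        fun s _ _ => (partsWeight_pos hq s).le

theorem totalWeight_mono {q : ℝ} (hq : 2 ≤ q) : Monotone (totalWeight q) :=
  monotone_nat_of_le_succ (totalWeight_le_succ hq)

/-- What is needed is the bound `1/(1-t)`; the subtracted power of `t` makes the induction close, by
leaving room for the next term. -/
theorem sum_totalWeight_mul_pow_le {q : ℝ} (hq : 2 ≤ q) (n : ℕ) :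
    ∑ m ∈ Finset.range (n + 2), totalWeight q m * (1 / q) ^ (2 * m)
      ≤ 1 / (1 - 1 / q) - (1 / q) ^ (2 * n + 1) := by
  have hrec := fun k hk => totalWeight_le_sum hq (n := k) hk
  obtain ⟨ht0, ht⟩ := one_div_mem_Ioc hq
  generalize 1 / q = t at *
  have h1t : 0 < 1 - t := by linarith
  induction n with
  | zero =>
    have h1 := hrec 1 le_rfl
    simp only [Finset.sum_range_succ, Finset.sum_range_zero, totalWeight_zero] at h1 ⊢
    have h2 : totalWeight q 1 * t ^ 2 ≤ 1 / (1 - t) * t ^ 2 :=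
      mul_le_mul_of_nonneg_right (by simpa using h1) (by positivity)
    -- The correction `t` is what makes the base case exact once `Z_1 ≤ 1/(1-t)` is inserted.
    have h3 : 1 / (1 - t) - t = 1 + 1 / (1 - t) * t ^ 2 := by field_simp; ring
    norm_num at h2 h3 ⊢
    linarith
  | succ n ih =>
    rw [Finset.sum_range_succ]
    have h1 : totalWeight q (n + 2) ≤ 1 / (1 - t) ^ 2 := by
      refine (hrec (n + 2) (by omega)).trans ?_
      rw [div_le_div_iff₀ h1t (by positivity)]
      have h2 : ∑ m ∈ Finset.range (n + 2), totalWeight q m * t ^ (2 * m) ≤ 1 / (1 - t) :=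
        ih.trans (by have : 0 < t ^ (2 * n + 1) := by positivity
                     linarith)
      rw [le_div_iff₀ h1t] at h2
      nlinarith
    have h3 : totalWeight q (n + 2) * t ^ (2 * (n + 2)) ≤ 1 / (1 - t) ^ 2 * t ^ (2 * (n + 2)) :=
      mul_le_mul_of_nonneg_right h1 (by positivity)
    -- For `t ≤ 1/2` the left side is at most `1/2` and the right side at least `3/4`.
    have h4 : 1 / (1 - t) ^ 2 * t ^ 3 ≤ 1 - t ^ 2 := by
      rw [div_mul_eq_mul_div, div_le_iff₀ (by positivity)]
      have a1 : t ^ 3 ≤ 1 / 8 := by nlinarith [mul_pos ht0 ht0]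
      have a2 : (1 : ℝ) / 4 ≤ (1 - t) ^ 2 := by nlinarith
      have a3 : (3 : ℝ) / 4 ≤ 1 - t ^ 2 := by nlinarith
      nlinarith
    have h5 := mul_le_mul_of_nonneg_right h4 (show 0 ≤ t ^ (2 * n + 1) by positivity)
    have e1 : 1 / (1 - t) ^ 2 * t ^ (2 * (n + 2)) = 1 / (1 - t) ^ 2 * t ^ 3 * t ^ (2 * n + 1) := by
      ring
    have e2 : (1 - t ^ 2) * t ^ (2 * n + 1) = t ^ (2 * n + 1) - t ^ (2 * (n + 1) + 1) := by ring
    linarith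

theorem totalWeight_le {q : ℝ} (hq : 2 ≤ q) (n : ℕ) :
    totalWeight q n ≤ 1 / (1 - 1 / q) ^ 2 := by
  obtain ⟨ht0, ht⟩ := one_div_mem_Ioc hq
  have h1t : 0 < 1 - 1 / q := by linarith
  refine (totalWeight_mono hq (by omega : n ≤ n + 2)).trans
    ((totalWeight_le_sum hq (by omega)).trans ?_)
  have h := sum_totalWeight_mul_pow_le hq n
  have h' : (0 : ℝ) < (1 / q) ^ (2 * n + 1) := by positivity
  rw [pow_two, ← div_div]
  exact div_le_div_of_nonneg_right (by linarith) h1t.le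

/-! ### The probability as a ratio of weights -/

theorem tprod_one_sub_one_div_pow_ne_zero {q : ℝ} (hq : 2 ≤ q) :
    (∏' i : ℕ, (1 - 1 / q ^ (i + 1))) ≠ 0 := by
  obtain ⟨ht0, ht⟩ := one_div_mem_Ioc hq
  simp only [sub_eq_add_neg]
  refine tprod_one_add_ne_zero_of_summable (fun i => ?_) ?_
  · have := one_div_pow_lt_one hq i
    intro h
    linarith
  · simp only [norm_neg, ← one_div_pow, norm_pow]
    refine (summable_nat_add_iff 1).2 (summable_geometric_of_lt_one (norm_nonneg _) ?_)
    rw [Real.norm_of_nonneg ht0.le]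
    linarith

theorem tildeP_eq {q : ℝ} (hq : 2 ≤ q) {n : ℕ} (lam : n.Partition) :
    tildeP q lam
      = (∏' i : ℕ, (1 - 1 / q ^ (i + 1))) / q ^ n * partsWeight q lam.parts := by
  have h : tildeP q lam = (∏' i : ℕ, (1 - 1 / q ^ (i + 1))) / autProd q n lam.parts := rfl
  rw [h, partsWeight, lam.parts_sum]
  have := (autProd_pos hq n lam.parts).ne'
  have hqn : q ^ n ≠ 0 := by positivity
  field_simp

theorem sum_partition_eq_sum_partsFinset {n : ℕ} (p : Multiset ℕ → Prop) [DecidablePred p]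
    (f : Multiset ℕ → ℝ) :
    ∑ lam : n.Partition with p lam.parts, f lam.parts = ∑ s ∈ partsFinset n with p s, f s := by
  rw [partsFinset, Finset.filter_image, Finset.sum_image fun a _ b _ h => Nat.Partition.ext h]

theorem sizePLargestLT_eq {q : ℝ} (hq : 2 ≤ q) (n r : ℕ) :
    sizePLargestLT n q r
      = (∑ s ∈ partsFinset n with s.sup < r, partsWeight q s) / totalWeight q n := by
  have hc : (∏' i : ℕ, (1 - 1 / q ^ (i + 1))) / q ^ n ≠ 0 :=
    div_ne_zero (tprod_one_sub_one_div_pow_ne_zero hq) (by positivity)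
  have htot : ∑ mu : n.Partition, partsWeight q mu.parts = totalWeight q n := by
    simpa [totalWeight] using
      sum_partition_eq_sum_partsFinset (n := n) (fun _ => True) (partsWeight q)
  simp only [sizePLargestLT, sizeP, tildeP_eq hq, ← Finset.mul_sum, htot]
  simp only [mul_div_mul_left _ _ hc, ← Finset.sum_div]
  rw [← sum_partition_eq_sum_partsFinset (fun s => s.sup < r) (partsWeight q)]
  rfl

theorem sizePLargestLT_nonneg {q : ℝ} (hq : 2 ≤ q) (n r : ℕ) : 0 ≤ sizePLargestLT n q r := by
  rw [sizePLargestLT_eq hq]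
  exact div_nonneg (Finset.sum_nonneg fun s _ => (partsWeight_pos hq s).le)
    (totalWeight_nonneg hq n)

/-! ### The two estimates -/

theorem sum_Ico_pow_le {t : ℝ} (ht0 : 0 ≤ t) (ht1 : t < 1) {n r : ℕ} (hr : r ≤ n) :
    ∑ L ∈ Finset.Ico 1 r, t ^ (2 * (n - L)) ≤ t ^ (2 * (n - r) + 2) / (1 - t ^ 2) := by
  have h2 : t ^ 2 < 1 := pow_lt_one₀ ht0 ht1 (by norm_num)
  suffices h : ∀ k ≤ n, ∑ L ∈ Finset.range k, t ^ (2 * (n - L))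
      ≤ t ^ (2 * (n - k) + 2) / (1 - t ^ 2) from
    (Finset.sum_le_sum_of_subset_of_nonneg
      (fun x hx => Finset.mem_range.2 (Finset.mem_Ico.1 hx).2) fun _ _ _ => by positivity).trans
      (h r hr)
  intro k
  induction k with
  | zero =>
    intro _
    exact div_nonneg (by positivity) (by linarith)
  | succ k ih =>
    intro hk
    rw [Finset.sum_range_succ]
    have h := ih (by omega)
    rw [show 2 * (n - k) = 2 * (n - (k + 1)) + 2 by omega] at h ⊢
    refine (add_le_add_left h _).trans_eq ?_
    have : (1 - t ^ 2) ≠ 0 := by linarith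
    field_simp
    ring

theorem sizePLargestLT_le {q : ℝ} (hq : 2 ≤ q) {n r : ℕ} (hr : r + 1 ≤ n) :
    sizePLargestLT n q r
      ≤ (1 / q) ^ (2 * (n - r) + 2) / (1 - (1 / q) ^ 2) / (1 - 1 / q) := by
  obtain ⟨ht0, ht⟩ := one_div_mem_Ioc hq
  have h1t : 0 < 1 - 1 / q := by linarith
  rw [sizePLargestLT_eq hq, div_le_iff₀ (totalWeight_pos hq n)]
  refine (sum_partsWeight_sup_lt_le hq (by omega)).trans ?_
  have hz := totalWeight_nonneg hq n
  calc _ ≤ ∑ L ∈ Finset.Ico 1 r, (1 / q) ^ (2 * (n - L)) * (totalWeight q n / (1 - 1 / q)) := by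
        refine Finset.sum_le_sum fun L _ => ?_
        rw [mul_comm (totalWeight q (n - L)), ← mul_div_assoc]
        gcongr
        exact totalWeight_mono hq (Nat.sub_le n L)
    _ = (∑ L ∈ Finset.Ico 1 r, (1 / q) ^ (2 * (n - L))) * (totalWeight q n / (1 - 1 / q)) := by
        rw [Finset.sum_mul]
    _ ≤ (1 / q) ^ (2 * (n - r) + 2) / (1 - (1 / q) ^ 2) * (totalWeight q n / (1 - 1 / q)) := by
        gcongr
        exact sum_Ico_pow_le ht0.le (by linarith) (by omega)
    _ = _ := by ring

/-- The contribution of the partition with the two parts `r - 1` and `n - r + 1`. -/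
theorem le_sizePLargestLT {q : ℝ} (hq : 2 ≤ q) {n r : ℕ} (hr : r + 1 ≤ n)
    (h2 : 2 * (n - r + 1) ≤ n) :
    (1 / q) ^ (2 * (n - r) + 2) * (1 - 1 / q) ≤ sizePLargestLT n q r := by
  have hz := totalWeight_le hq n
  have hz0 := totalWeight_pos hq n
  obtain ⟨ht0, ht⟩ := one_div_mem_Ioc hq
  have h1t : 0 < 1 - 1 / q := by linarith
  set j := n - r + 1 with hj
  set s : Multiset ℕ := (r - 1) ::ₘ j ::ₘ 0 with hs
  have hmem : s ∈ {s ∈ partsFinset n | s.sup < r} := by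
    refine Finset.mem_filter.2 ⟨mem_partsFinset.2 ⟨fun x hx => ?_, ?_⟩, ?_⟩
    · simp [hs] at hx
      omega
    · simp [hs]
      omega
    · simp [hs]
      omega
  have hw : (1 / q) ^ (2 * j) / ((1 - 1 / q) * (1 - (1 / q) ^ 2)) ≤ partsWeight q s := by
    have e1 : partsWeight q (j ::ₘ 0) = 1 / (1 - 1 / q) := by
      rw [partsWeight_cons hq (by omega) (by simp)]
      simp [partsWeight_zero]
    rw [hs, partsWeight_cons hq (by omega) (by intro x hx; simp at hx; omega), e1,
      one_div_mul_eq_div, div_div]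
    -- The two parts may coincide, so the factor is `1/(1-t)` or `1/(1-t^2)`; the smaller one is
    -- used.
    have hc : (j ::ₘ (0 : Multiset ℕ)).count (r - 1) ≤ 1 := by
      rw [Multiset.count_cons]
      simp
      split_ifs <;> simp
    have hp : (1 / q) ^ 2 ≤ (1 / q) ^ ((j ::ₘ (0 : Multiset ℕ)).count (r - 1) + 1) :=
      pow_le_pow_of_le_one ht0.le (by linarith) (by omega)
    have hp' : (1 / q) ^ ((j ::ₘ (0 : Multiset ℕ)).count (r - 1) + 1) < 1 :=
      pow_lt_one₀ ht0.le (by linarith) (by omega)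
    rw [show (j ::ₘ (0 : Multiset ℕ)).sum = j by simp]
    refine div_le_div_of_nonneg_left (by positivity) (mul_pos h1t (by linarith)) ?_
    exact mul_le_mul_of_nonneg_left (by linarith) h1t.le
  rw [sizePLargestLT_eq hq, le_div_iff₀ hz0]
  refine le_trans ?_ (hw.trans (Finset.single_le_sum
    (f := partsWeight q) (fun s _ => (partsWeight_pos hq s).le) hmem))
  rw [show 2 * (n - r) + 2 = 2 * j by omega]
  generalize 1 / q = t at *
  have h1t2 : 0 < 1 - t ^ 2 := by nlinarith
  calc t ^ (2 * j) * (1 - t) * totalWeight q n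
      ≤ t ^ (2 * j) * (1 - t) * (1 / (1 - t) ^ 2) := by gcongr
    _ = t ^ (2 * j) / (1 - t) := by field_simp
    _ ≤ _ := by
      refine div_le_div_of_nonneg_left (by positivity) (by positivity) ?_
      nlinarith

theorem mainTheorem2 (q : ℝ) (hq : 2 ≤ q) (n r : ℕ) (hr : r + 1 ≤ n) :
    sizePLargestLT n q r ≤
        (1 / (1 - 1 / q)) ^ 2 *
          (1 / q ^ (2 * n - 2 * r + 2) +
            1 / (1 - 1 / q ^ (2 * n + 1)) * (1 / q ^ (n + 1))) ∧
      sizePLargestLT n q r ≥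
        1 / q ^ (2 * n - 2 * r + 2)
          - 1 / (q ^ (n + 1) * (1 - 1 / q))
          - 1 / (q ^ (2 * n - 2 * r + 3) * (1 - 1 / q) ^ 2)
          - 1 / (q ^ (3 * n - 3 * r + 4) * (1 - 1 / q) ^ 3)
          - 1 / (1 - 1 / q) ^ 2 * (1 / (q ^ (2 * n + 3) * (1 - 1 / q ^ (2 * n + 3)))) := by
  obtain ⟨ht0, ht⟩ := one_div_mem_Ioc hq
  have h1t : 0 < 1 - 1 / q := by linarith
  have hexp : 2 * n - 2 * r + 2 = 2 * (n - r) + 2 := by omega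
  have hpow : ∀ k : ℕ, 1 / q ^ k = (1 / q) ^ k := fun k => (one_div_pow q k).symm
  have hlt : ∀ k : ℕ, 0 < 1 - 1 / q ^ (k + 1) := fun k => sub_pos.2 (one_div_pow_lt_one hq k)
  constructor
  · refine (sizePLargestLT_le hq hr).trans ?_
    have hpos : 0 ≤ 1 / (1 - 1 / q ^ (2 * n + 1)) * (1 / q ^ (n + 1)) :=
      mul_nonneg (div_nonneg zero_le_one (hlt (2 * n)).le) (by positivity)
    -- The first term of the bracket already suffices, since `1 - t^2 ≥ 1 - t`.
    have hmain : (1 / q) ^ (2 * (n - r) + 2) / (1 - (1 / q) ^ 2) / (1 - 1 / q)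
        ≤ (1 / (1 - 1 / q)) ^ 2 * (1 / q ^ (2 * n - 2 * r + 2)) := by
      rw [hexp, hpow, div_div, one_div_pow (1 - 1 / q), one_div_mul_eq_div]
      refine div_le_div_of_nonneg_left (by positivity) (by positivity) ?_
      nlinarith
    refine hmain.trans (mul_le_mul_of_nonneg_left (by linarith) (by positivity))
  · have hC : 0 ≤ 1 / (q ^ (3 * n - 3 * r + 4) * (1 - 1 / q) ^ 3) := by positivity
    have hD : 0 ≤ 1 / (1 - 1 / q) ^ 2 * (1 / (q ^ (2 * n + 3) * (1 - 1 / q ^ (2 * n + 3)))) := by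
      have := hlt (2 * n + 2)
      positivity
    have hA : 1 / q ^ (n + 1) ≤ 1 / (q ^ (n + 1) * (1 - 1 / q)) :=
      one_div_le_one_div_of_le (by positivity) (mul_le_of_le_one_right (by positivity) (by linarith))
    have hA0 : 0 ≤ 1 / q ^ (n + 1) := by positivity
    have hB : 1 / q ^ (2 * n - 2 * r + 3) ≤ 1 / (q ^ (2 * n - 2 * r + 3) * (1 - 1 / q) ^ 2) :=
      one_div_le_one_div_of_le (by positivity)
        (mul_le_of_le_one_right (by positivity) (pow_le_one₀ h1t.le (by linarith)))
    have hB0 : 0 ≤ 1 / q ^ (2 * n - 2 * r + 3) := by positivity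
    rcases le_or_gt (2 * (n - r + 1)) n with h2 | h2
    · have h := le_sizePLargestLT hq hr h2
      have e : (1 / q) ^ (2 * (n - r) + 2) * (1 - 1 / q)
          = 1 / q ^ (2 * n - 2 * r + 2) - 1 / q ^ (2 * n - 2 * r + 3) := by
        rw [show 2 * n - 2 * r + 3 = 2 * (n - r) + 2 + 1 by omega, hexp, hpow, hpow]
        ring
      linarith
    -- Here `2n - 2r + 2 ≥ n + 1`, so the first subtracted term outweighs the leading one.
    · have h := sizePLargestLT_nonneg hq n r
      have : 1 / q ^ (2 * n - 2 * r + 2) ≤ 1 / q ^ (n + 1) :=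
        one_div_le_one_div_of_le (by positivity)
          (pow_le_pow_right₀ (by linarith) (by omega))
      linarith
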